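/- Let $n = 2k$, where $k \ge 3$ is an odd integer. Consider the lazy walk on the hypercube $(\mathbb Z/2\mathbb Z)^n$ that at each step stays put with probability $1/2$ and with probability $1/2$ flips a uniformly random set of $k = n/2$ coordinates; that is, the random walk driven by the probability measure $P$ with $P(0) = \frac12$, $P(g) = \frac{1}{2\binom{n}{k}}$ if $g$ has exactly $k$ ones, and $P(g) = 0$ otherwise. Let $P^{*l}$ denote the $l$-fold convolution power of $P$ (the law of the walk after $l$ steps from $0$), let $U$ be the uniform distribution on $(\mathbb Z/2\mathbb Z)^n$, and let $\|\mu-\nu\|_{T.V.} = \frac12\sum_x|\mu(x)-\nu(x)|$. Then for every real $c > 0$ and every integer $$l \ge 8\log\frac n2 + c\sqrt{\log\frac n2},$$ where $\log$ is the natural logarithm, one has $$\|P^{*l} - U\|_{T.V.} \le \frac{1}{c^2}.$$ -/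

import Mathlib

namespace KFlip

/-- The hypercube `(ℤ/2ℤ)ⁿ`, as an additive group. -/
abbrev Cube (n : ℕ) : Type := Fin n → ZMod 2

/-- One step of the lazy `k`-flip walk: mass `1/2` at the identity, and mass `1/(2 * C(n,k))` at
each vector with exactly `k` ones. (For `k = 0` the two contributions at the identity add up.) -/
noncomputable def lazyFlip (n k : ℕ) (g : Cube n) : ℝ :=
  (if g = 0 then 1 / 2 else 0) + (if hammingNorm g = k then 1 / (2 * (n.choose k : ℝ)) else 0)

/-- Convolution of two real functions on a finite additive group. -/
def conv {G : Type*} [AddCommGroup G] [Fintype G] (f g : G → ℝ) (x : G) : ℝ :=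
  ∑ y : G, f y * g (x - y)

/-- The `l`-fold convolution power; the `0`-th power is the point mass at the identity. -/
def convPow {G : Type*} [AddCommGroup G] [Fintype G] [DecidableEq G] (f : G → ℝ) : ℕ → G → ℝ
  | 0 => Pi.single 0 1
  | l + 1 => conv f (convPow f l)

/-- The uniform distribution on a finite type. -/
noncomputable def uniform (G : Type*) [Fintype G] (_x : G) : ℝ :=
  1 / (Fintype.card G : ℝ)

/-- Total variation distance between two probability mass functions on a finite type. -/
noncomputable def tvDist {G : Type*} [Fintype G] (p q : G → ℝ) : ℝ :=
  (1 / 2) * ∑ x : G, |p x - q x|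

end KFlip

/-!
At a character of weight `j` the walk that flips `k` of `2 * k` coordinates has as eigenvalue the
normalized Krawtchouk number `K_j(k) / C(2k, j)`, where `K_j(k)` is the coefficient of `X ^ j` in
`(1 - X) ^ k * (1 + X) ^ k = (1 - X ^ 2) ^ k`. Hence it is `0` for odd `j` and
`± C(k, i) / C(2k, 2i)` for `j = 2i`, which is at most `1 / k` in absolute value unless `j` is `0`
or `2k`.

The usual Fourier (`L²`) bound is too weak for the lazy walk, which has eigenvalue `1 / 2` at all
`2 ^ (2k - 1)` characters of odd weight. Conditioning on the number `m` of actual moves avoids this: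
after `m` moves the vector has the parity of `m`, as `k` is odd, and the Fourier bound puts its law
within `k ^ 2 / 2 * (1 / k) ^ m` of the uniform law on that parity class. Averaging over the
binomial variable `m` leaves `k ^ 2 / 2 * ((1 + 1 / k) / 2) ^ l`.
-/

namespace KFlip

open Finset Polynomial

section TotalVariation

variable {G : Type*} [Fintype G]

lemma tvDist_le_one {p q : G → ℝ} (hp : ∀ x, 0 ≤ p x) (hq : ∀ x, 0 ≤ q x)
    (hp_sum : ∑ x, p x = 1) (hq_sum : ∑ x, q x = 1) : tvDist p q ≤ 1 := by
  have h : ∑ x, |p x - q x| ≤ ∑ x, (p x + q x) := by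
    gcongr with x
    simpa only [abs_of_nonneg (hp x), abs_of_nonneg (hq x)] using abs_sub (p x) (q x)
  rw [sum_add_distrib, hp_sum, hq_sum] at h
  rw [tvDist]
  linarith

lemma tvDist_sum_smul_le {α : Type*} {s : Finset α} {w : α → ℝ} (hw : ∀ a ∈ s, 0 ≤ w a)
    (p q : α → G → ℝ) :
    tvDist (∑ a ∈ s, w a • p a) (∑ a ∈ s, w a • q a) ≤ ∑ a ∈ s, w a * tvDist (p a) (q a) := by
  have h : ∀ x, |(∑ a ∈ s, w a • p a) x - (∑ a ∈ s, w a • q a) x|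
      ≤ ∑ a ∈ s, w a * |p a x - q a x| := fun x => by
    simp only [Finset.sum_apply, Pi.smul_apply, smul_eq_mul, ← sum_sub_distrib, ← mul_sub]
    refine (abs_sum_le_sum_abs _ _).trans_eq (sum_congr rfl fun a ha => ?_)
    rw [abs_mul, abs_of_nonneg (hw a ha)]
  calc tvDist (∑ a ∈ s, w a • p a) (∑ a ∈ s, w a • q a)
      ≤ 1 / 2 * ∑ x, ∑ a ∈ s, w a * |p a x - q a x| := by
        rw [tvDist]
        gcongr with x
        exact h x
    _ = ∑ a ∈ s, w a * tvDist (p a) (q a) := by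
        rw [sum_comm, mul_sum]
        refine sum_congr rfl fun a _ => ?_
        rw [tvDist, ← mul_sum, mul_left_comm]

end TotalVariation

section Convolution

variable {G : Type*} [AddCommGroup G] [Fintype G]

/-- Convolution as a bilinear map: `convLin f` is the operator of convolution by `f`. The powers
of these operators carry the binomial theorem over to convolution powers. -/
def convLin : (G → ℝ) →ₗ[ℝ] Module.End ℝ (G → ℝ) :=
  LinearMap.mk₂ ℝ conv
    (fun f₁ f₂ g => funext fun x => by simp [conv, add_mul, sum_add_distrib])
    (fun a f g => funext fun x => by simp [conv, mul_sum, mul_assoc])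
    (fun f g₁ g₂ => funext fun x => by simp [conv, mul_add, sum_add_distrib])
    (fun a f g => funext fun x => by simp [conv, mul_sum, mul_left_comm])

/-- The Fourier coefficient of `f` at the real character `ψ`. -/
def fourier (f : G → ℝ) (ψ : AddChar G ℝ) : ℝ := ∑ x, f x * ψ x

lemma fourier_zero_right (f : G → ℝ) : fourier f 0 = ∑ x, f x := by
  simp [fourier]

lemma fourier_sub (f g : G → ℝ) (ψ : AddChar G ℝ) :
    fourier (f - g) ψ = fourier f ψ - fourier g ψ := by
  simp [fourier, sub_mul, sum_sub_distrib]

lemma fourier_conv (f g : G → ℝ) (ψ : AddChar G ℝ) :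
    fourier (conv f g) ψ = fourier f ψ * fourier g ψ := by
  simp only [fourier, conv, sum_mul]
  rw [sum_comm]
  refine sum_congr rfl fun y _ => ?_
  rw [mul_sum, ← Equiv.sum_comp (Equiv.addRight y)]
  refine sum_congr rfl fun x _ => ?_
  rw [Equiv.coe_addRight, add_sub_cancel_right, AddChar.map_add_eq_mul]
  ring

variable [DecidableEq G]

lemma convLin_single_zero : convLin (Pi.single 0 1 : G → ℝ) = 1 := by
  refine LinearMap.ext fun g => funext fun x => ?_
  simp [convLin, conv, Pi.single_apply]

lemma convPow_eq_convLin_pow (f : G → ℝ) (m : ℕ) :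
    convPow f m = (convLin f ^ m) (Pi.single 0 1) := by
  induction m with
  | zero => rfl
  | succ m ih =>
    rw [pow_succ', Module.End.mul_apply, ← ih]
    rfl

lemma fourier_convPow (f : G → ℝ) (m : ℕ) (ψ : AddChar G ℝ) :
    fourier (convPow f m) ψ = fourier f ψ ^ m := by
  induction m with
  | zero => simp [fourier, convPow, Pi.single_apply]
  | succ m ih => rw [convPow, fourier_conv, ih, pow_succ']

end Convolution

section BinomialMixture

/-- The probability that a binomial variable with parameters `l` and `1 / 2` equals `m`: the law of
the number of moves made by a lazy walk in `l` steps. -/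
noncomputable def binomWeight (l m : ℕ) : ℝ := (l.choose m : ℝ) / 2 ^ l

lemma binomWeight_nonneg (l m : ℕ) : 0 ≤ binomWeight l m := by
  unfold binomWeight
  positivity

lemma sum_binomWeight_mul_pow (l : ℕ) (t : ℝ) :
    ∑ m ∈ range (l + 1), binomWeight l m * t ^ m = ((t + 1) / 2) ^ l := by
  rw [div_pow, add_pow, sum_div]
  refine sum_congr rfl fun m _ => ?_
  rw [binomWeight, one_pow]
  ring

lemma convPow_lazy {G : Type*} [AddCommGroup G] [Fintype G] [DecidableEq G] (f : G → ℝ) (l : ℕ) :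
    convPow ((1 / 2 : ℝ) • (f + Pi.single 0 1)) l
      = ∑ m ∈ range (l + 1), binomWeight l m • convPow f m := by
  have h : convLin ((1 / 2 : ℝ) • (f + Pi.single 0 1)) = (1 / 2 : ℝ) • (convLin f + 1) := by
    rw [map_smul, map_add, convLin_single_zero]
  have h_pow := (Commute.one_right (convLin f)).add_pow l
  simp only [convPow_eq_convLin_pow, h, _root_.smul_pow, h_pow, one_pow, mul_one,
    LinearMap.smul_apply, LinearMap.sum_apply, smul_sum]
  refine sum_congr rfl fun m _ => ?_
  rw [← nsmul_eq_mul', LinearMap.smul_apply, ← Nat.cast_smul_eq_nsmul ℝ, smul_smul, binomWeight,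
    div_pow, one_pow, one_div_mul_eq_div]

end BinomialMixture

section Walsh

lemma add_eq_zero_iff_eq {G : Type*} [AddCommGroup G] [Module (ZMod 2) G] {x z : G} :
    x + z = 0 ↔ x = z := by
  rw [← ZModModule.sub_eq_add, sub_eq_zero]

variable {ι : Type*} [Fintype ι]

/-- The nontrivial character of `ℤ/2ℤ`. -/
def sign : AddChar (ZMod 2) ℝ := AddChar.zmodChar 2 neg_one_sq

lemma eq_one_of_ne_zero {a : ZMod 2} (ha : a ≠ 0) : a = 1 :=
  Fin.eq_one_of_ne_zero a ha

lemma sign_of_ne_zero {a : ZMod 2} (ha : a ≠ 0) : sign a = -1 := by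
  simp [sign, AddChar.zmodChar_apply, eq_one_of_ne_zero ha, ZMod.val_one]

/-- The Walsh function `x ↦ (-1) ^ ⟨y, x⟩`, the character of the cube indexed by `y`. -/
def walsh (y : ι → ZMod 2) : AddChar (ι → ZMod 2) ℝ where
  toFun x := ∏ i, sign (y i * x i)
  map_zero_eq_one' := by simp
  map_add_eq_mul' x z := by simp [mul_add, AddChar.map_add_eq_mul, prod_mul_distrib]

lemma walsh_apply (y x : ι → ZMod 2) : walsh y x = ∏ i, sign (y i * x i) := rfl

lemma walsh_comm (y x : ι → ZMod 2) : walsh y x = walsh x y := by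
  simp only [walsh_apply, mul_comm]

lemma walsh_zero : walsh (0 : ι → ZMod 2) = 0 := by
  ext x
  simp [walsh_apply]

lemma walsh_add (y z : ι → ZMod 2) : walsh (y + z) = walsh y + walsh z := by
  ext x
  rw [AddChar.add_apply, walsh_comm, AddChar.map_add_eq_mul, walsh_comm x, walsh_comm x]

lemma walsh_one_apply (x : ι → ZMod 2) : walsh 1 x = (-1) ^ hammingNorm x := by
  rw [walsh_apply, hammingNorm, ← prod_const, prod_filter]
  refine prod_congr rfl fun i _ => ?_
  rw [Pi.one_apply, one_mul]
  split_ifs with hx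
  · exact sign_of_ne_zero hx
  · rw [not_not.mp hx, AddChar.map_zero_eq_one]

lemma hammingNorm_eq_card_iff {y : ι → ZMod 2} : hammingNorm y = Fintype.card ι ↔ y = 1 := by
  refine ⟨fun hy => ?_, fun hy => by simp [hy, hammingNorm]⟩
  have h : ∀ i, y i ≠ 0 := by
    simpa using (card_eq_iff_eq_univ _).mp hy
  ext1 i
  exact eq_one_of_ne_zero (h i)

lemma walsh_single_apply [DecidableEq ι] (y : ι → ZMod 2) (i : ι) :
    walsh y (Pi.single i 1) = sign (y i) := by
  rw [walsh_apply, prod_eq_single i (fun j _ hj => by simp [hj]) (by simp)]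
  simp

lemma walsh_eq_zero_iff {y : ι → ZMod 2} : walsh y = 0 ↔ y = 0 := by
  classical
  refine ⟨fun h => ?_, fun h => h ▸ walsh_zero⟩
  ext1 i
  by_contra hi
  have h1 : sign (y i) = 1 := by rw [← walsh_single_apply, h, AddChar.zero_apply]
  rw [sign_of_ne_zero hi] at h1
  norm_num at h1

variable [DecidableEq ι]

lemma sum_walsh (y : ι → ZMod 2) :
    ∑ x, walsh y x = if y = 0 then 2 ^ Fintype.card ι else 0 := by
  classical
  simp [AddChar.sum_eq_ite, walsh_eq_zero_iff]

lemma sum_sq_fourier_walsh (f : (ι → ZMod 2) → ℝ) :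
    ∑ y, fourier f (walsh y) ^ 2 = 2 ^ Fintype.card ι * ∑ x, f x ^ 2 := by
  have h : ∀ y, fourier f (walsh y) ^ 2 = ∑ x, ∑ z, f x * f z * walsh (x + z) y := fun y => by
    rw [sq, fourier, sum_mul_sum]
    refine sum_congr rfl fun x _ => sum_congr rfl fun z _ => ?_
    rw [walsh_add, AddChar.add_apply, walsh_comm x, walsh_comm z]
    ring
  simp_rw [h]
  rw [sum_comm, mul_sum]
  refine sum_congr rfl fun x _ => ?_
  rw [sum_comm]
  simp only [← mul_sum, sum_walsh, add_eq_zero_iff_eq, mul_ite, mul_zero,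
    sum_ite_eq, mem_univ, if_true]
  ring

lemma sq_two_mul_tvDist_le (p q : (ι → ZMod 2) → ℝ) :
    (2 * tvDist p q) ^ 2 ≤ ∑ y, fourier (p - q) (walsh y) ^ 2 := by
  have h : (∑ x, |p x - q x|) ^ 2 ≤ 2 ^ Fintype.card ι * ∑ x, |p x - q x| ^ 2 := by
    simpa using sq_sum_le_card_mul_sum_sq (s := univ) (f := fun x => |p x - q x|)
  rw [sum_sq_fourier_walsh]
  simpa [tvDist] using h

end Walsh

section Krawtchouk

/-- The value at `j` of the Krawtchouk polynomial of degree `k` for the cube of dimension `n`, read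
off from its generating function in `k`. -/
noncomputable def krawtchouk (n k j : ℕ) : ℝ :=
  (((1 : ℝ[X]) - X) ^ j * (1 + X) ^ (n - j)).coeff k

variable {ι : Type*} [Fintype ι] [DecidableEq ι]

lemma sum_walsh_mul_X_pow_hammingNorm (y : ι → ZMod 2) :
    ∑ x, C (walsh y x) * (X : ℝ[X]) ^ hammingNorm x
      = (1 - X) ^ hammingNorm y * (1 + X) ^ (Fintype.card ι - hammingNorm y) := by
  let term (i : ι) (a : ZMod 2) : ℝ[X] := C (sign (y i * a)) * (if a ≠ 0 then X else 1)
  have h_prod : ∀ x : ι → ZMod 2,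
      C (walsh y x) * (X : ℝ[X]) ^ hammingNorm x = ∏ i, term i (x i) := fun x => by
    rw [prod_mul_distrib, walsh_apply, map_prod, hammingNorm, ← prod_const, prod_filter]
  have h_sum : ∀ i, ∑ a, term i a = if y i ≠ 0 then 1 - X else 1 + X := fun i => by
    have h : ∑ a, term i a = term i 0 + term i 1 := Fin.sum_univ_two _
    rw [h]
    by_cases hy : y i = 0
    · simp [term, hy]
    · simp [term, hy, sign_of_ne_zero, sub_eq_add_neg]
  have h_card : #{i | ¬ y i ≠ 0} = Fintype.card ι - hammingNorm y := by
    rw [filter_not, card_sdiff_of_subset (filter_subset _ _), card_univ]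
    rfl
  calc ∑ x, C (walsh y x) * (X : ℝ[X]) ^ hammingNorm x
      = ∏ i, ∑ a, term i a := by
        simp_rw [h_prod]
        rw [prod_univ_sum, Fintype.piFinset_univ]
    _ = (1 - X) ^ hammingNorm y * (1 + X) ^ (Fintype.card ι - hammingNorm y) := by
        simp_rw [h_sum]
        rw [prod_ite, prod_const, prod_const, h_card]
        rfl

lemma sum_walsh_filter_hammingNorm (y : ι → ZMod 2) (k : ℕ) :
    ∑ x with hammingNorm x = k, walsh y x = krawtchouk (Fintype.card ι) k (hammingNorm y) := by
  simp only [krawtchouk, ← sum_walsh_mul_X_pow_hammingNorm, finsetSum_coeff, coeff_C_mul,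
    coeff_X_pow, sum_filter, mul_ite, mul_one, mul_zero, eq_comm]

variable (ι) in
lemma card_filter_hammingNorm (k : ℕ) :
    #{x : ι → ZMod 2 | hammingNorm x = k} = (Fintype.card ι).choose k := by
  have h := sum_walsh_filter_hammingNorm (0 : ι → ZMod 2) k
  rw [walsh_zero, hammingNorm_zero, krawtchouk, pow_zero, one_mul, Nat.sub_zero,
    coeff_one_add_X_pow] at h
  simpa using h

lemma sum_comp_hammingNorm (g : ℕ → ℝ) :
    ∑ y : ι → ZMod 2, g (hammingNorm y)
      = ∑ j ∈ range (Fintype.card ι + 1), (Fintype.card ι).choose j * g j := by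
  have h : ∀ y ∈ (univ : Finset (ι → ZMod 2)), hammingNorm y ∈ range (Fintype.card ι + 1) :=
    fun y _ => mem_range_succ_iff.mpr hammingNorm_le_card_fintype
  rw [← sum_fiberwise_of_maps_to' h]
  simp only [sum_const, card_filter_hammingNorm, nsmul_eq_mul]

/- Both sides count the pairs `(x, y)` with `x` of weight `k` and `y` of weight `j`, weighted by the
symmetric kernel `walsh y x`. -/
lemma choose_mul_krawtchouk (n k j : ℕ) :
    (n.choose j : ℝ) * krawtchouk n k j = n.choose k * krawtchouk n j k := by
  have h : ∀ k j : ℕ, (n.choose j : ℝ) * krawtchouk n k j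
      = ∑ y : Cube n with hammingNorm y = j, ∑ x with hammingNorm x = k, walsh y x := fun k j => by
    have hy : ∀ y ∈ ({y | hammingNorm y = j} : Finset (Cube n)),
        ∑ x with hammingNorm x = k, walsh y x = krawtchouk n k j := fun y hy => by
      rw [sum_walsh_filter_hammingNorm, Fintype.card_fin, (mem_filter.mp hy).2]
    rw [sum_congr rfl hy, sum_const, card_filter_hammingNorm, Fintype.card_fin, nsmul_eq_mul]
  rw [h, h, sum_comm]
  exact sum_congr rfl fun y _ => sum_congr rfl fun x _ => walsh_comm _ _

lemma coeff_one_sub_X_pow (R : Type*) [CommRing R] (k i : ℕ) :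
    ((1 - X : R[X]) ^ k).coeff i = (-1) ^ i * (k.choose i : R) := by
  have h : (1 - X : R[X]) ^ k = ((1 + X) ^ k).comp (C (-1) * X) := by
    simp [sub_eq_add_neg]
  rw [h, comp_C_mul_X_coeff, coeff_one_add_X_pow, mul_comm]

lemma krawtchouk_two_mul (k j : ℕ) :
    krawtchouk (2 * k) j k = if 2 ∣ j then (-1) ^ (j / 2) * (k.choose (j / 2) : ℝ) else 0 := by
  have h : (1 - X : ℝ[X]) ^ k * (1 + X) ^ (2 * k - k) = expand ℝ 2 ((1 - X) ^ k) := by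
    rw [two_mul, Nat.add_sub_cancel, ← mul_pow, map_pow, map_sub, map_one, expand_X]
    ring
  rw [krawtchouk, h, coeff_expand two_pos, coeff_one_sub_X_pow]

lemma self_le_choose {k i : ℕ} (hi : 0 < i) (hik : i < k) : k ≤ k.choose i := by
  obtain ⟨i, rfl⟩ := Nat.exists_eq_add_one.mpr hi
  induction hik with
  | refl => simp
  | @step k hk ih =>
    have h : 0 < k.choose i := Nat.choose_pos (Nat.le_of_succ_le (Nat.le_of_succ_le hk))
    rw [Nat.choose_succ_succ']
    omega

lemma sq_choose_le (k i : ℕ) : k.choose i ^ 2 ≤ (2 * k).choose (2 * i) := by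
  rw [two_mul k, Nat.add_choose_eq, sq]
  exact single_le_sum (f := fun ij : ℕ × ℕ => k.choose ij.1 * k.choose ij.2)
    (fun _ _ => Nat.zero_le _) (by simp [two_mul] : (i, i) ∈ antidiagonal (2 * i))

lemma sq_krawtchouk_two_mul_le (k j : ℕ) :
    krawtchouk (2 * k) j k ^ 2 ≤ (2 * k).choose j := by
  rw [krawtchouk_two_mul]
  split_ifs with h
  · obtain ⟨i, rfl⟩ := h
    rw [Nat.mul_div_cancel_left i two_pos, mul_pow, ← pow_mul, mul_comm i, pow_mul, neg_one_sq,
      one_pow, one_mul]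
    exact_mod_cast sq_choose_le k i
  · simp

lemma le_abs_krawtchouk_two_mul {k j : ℕ} (hj : 0 < j) (hjk : j < 2 * k)
    (h : krawtchouk (2 * k) j k ≠ 0) : (k : ℝ) ≤ |krawtchouk (2 * k) j k| := by
  rw [krawtchouk_two_mul] at h ⊢
  split_ifs at h ⊢ with h2
  · have hle : k ≤ k.choose (j / 2) := self_le_choose (by omega) (by omega)
    simpa [abs_mul] using hle
  · exact absurd rfl h

lemma abs_krawtchouk_two_mul_div_choose_le {k j : ℕ} (hj : 0 < j) (hjk : j < 2 * k) :
    |krawtchouk (2 * k) j k / (2 * k).choose j| ≤ 1 / k := by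
  have hk : (0 : ℝ) < k := by exact_mod_cast (by omega : 0 < k)
  have hc : (0 : ℝ) < (2 * k).choose j := by exact_mod_cast Nat.choose_pos hjk.le
  by_cases h : krawtchouk (2 * k) j k = 0
  · rw [h, zero_div, abs_zero]
    positivity
  rw [abs_div, abs_of_pos hc, div_le_div_iff₀ hc hk, one_mul]
  calc |krawtchouk (2 * k) j k| * k
      ≤ |krawtchouk (2 * k) j k| * |krawtchouk (2 * k) j k| := by
        gcongr
        exact le_abs_krawtchouk_two_mul hj hjk h
    _ ≤ (2 * k).choose j := by
        rw [← sq, sq_abs]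
        exact sq_krawtchouk_two_mul_le k j

/- One factor `(K / C) ^ 2` pays for the multiplicity `C`, since `K ^ 2 ≤ C`. -/
lemma choose_mul_krawtchouk_div_choose_pow_le {k j : ℕ} (hj : 0 < j) (hjk : j < 2 * k) (m : ℕ) :
    ((2 * k).choose j : ℝ) * ((krawtchouk (2 * k) j k / (2 * k).choose j) ^ (m + 1)) ^ 2
      ≤ ((1 / k : ℝ) ^ m) ^ 2 := by
  have hK := sq_krawtchouk_two_mul_le k j
  have hquot := abs_krawtchouk_two_mul_div_choose_le hj hjk
  have hc : (0 : ℝ) < (2 * k).choose j := by exact_mod_cast Nat.choose_pos hjk.le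
  set K := krawtchouk (2 * k) j k
  set c := ((2 * k).choose j : ℝ)
  calc c * ((K / c) ^ (m + 1)) ^ 2 = K ^ 2 / c * (|K / c| ^ m) ^ 2 := by
        rw [← abs_pow, sq_abs, pow_succ (K / c) m, mul_pow, div_pow K c 2]
        field_simp
    _ ≤ 1 * ((1 / k : ℝ) ^ m) ^ 2 := by
        gcongr
        exact div_le_one_of_le₀ hK hc.le
    _ = ((1 / k : ℝ) ^ m) ^ 2 := one_mul _

end Krawtchouk

section ParityUniform

variable {ι : Type*} [Fintype ι]

/-- The uniform distribution on the vectors whose number of ones has the parity of `m`. For odd `k`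
it is the limiting law of the non-lazy `k`-flip walk at times of the parity of `m`. -/
noncomputable def parityUniform (m : ℕ) (x : ι → ZMod 2) : ℝ :=
  if Even (m + hammingNorm x) then 2 / 2 ^ Fintype.card ι else 0

lemma parityUniform_nonneg (m : ℕ) (x : ι → ZMod 2) : 0 ≤ parityUniform m x := by
  unfold parityUniform
  positivity

lemma parityUniform_eq_walsh (m : ℕ) (x : ι → ZMod 2) :
    parityUniform m x = (1 + (-1) ^ m * walsh 1 x) / 2 ^ Fintype.card ι := by
  rw [walsh_one_apply, ← pow_add, parityUniform]
  split_ifs with h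
  · rw [h.neg_one_pow, one_add_one_eq_two]
  · simp [(Nat.not_even_iff_odd.mp h).neg_one_pow]

variable [DecidableEq ι]

lemma fourier_parityUniform (m : ℕ) (y : ι → ZMod 2) :
    fourier (parityUniform m) (walsh y)
      = (if y = 0 then 1 else 0) + (-1) ^ m * (if y = 1 then 1 else 0) := by
  have h : ∀ x, parityUniform m x * walsh y x
      = 1 / 2 ^ Fintype.card ι * walsh y x
        + (-1) ^ m / 2 ^ Fintype.card ι * walsh (y + 1) x := fun x => by
    rw [parityUniform_eq_walsh, walsh_add, AddChar.add_apply]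
    ring
  simp only [fourier, h, sum_add_distrib, ← mul_sum, sum_walsh, add_eq_zero_iff_eq]
  split_ifs <;> simp

lemma sum_parityUniform [Nonempty ι] (m : ℕ) : ∑ x : ι → ZMod 2, parityUniform m x = 1 := by
  rw [← fourier_zero_right, ← walsh_zero, fourier_parityUniform]
  simp

lemma uniform_eq_sum_parityUniform {l : ℕ} (hl : l ≠ 0) :
    uniform (ι → ZMod 2) = ∑ m ∈ range (l + 1), binomWeight l m • parityUniform m := by
  ext x
  have h : ∀ m, binomWeight l m * parityUniform m x
      = 1 / 2 ^ Fintype.card ι * (binomWeight l m * 1 ^ m)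
        + walsh 1 x / 2 ^ Fintype.card ι * (binomWeight l m * (-1) ^ m) := fun m => by
    rw [parityUniform_eq_walsh, one_pow]
    ring
  simp only [Finset.sum_apply, Pi.smul_apply, smul_eq_mul, h, sum_add_distrib, ← mul_sum,
    sum_binomWeight_mul_pow]
  simp [uniform, hl]

end ParityUniform

section FlipWalk

/-- One step of the walk that flips a uniformly random set of `k` coordinates: `lazyFlip` without
the laziness. -/
noncomputable def flipStep (n k : ℕ) (x : Cube n) : ℝ :=
  if hammingNorm x = k then 1 / (n.choose k : ℝ) else 0

lemma lazyFlip_eq_smul_flipStep_add_single (n k : ℕ) :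
    lazyFlip n k = (1 / 2 : ℝ) • (flipStep n k + Pi.single 0 1) := by
  ext x
  simp only [lazyFlip, flipStep, Pi.smul_apply, Pi.add_apply, Pi.single_apply, smul_eq_mul]
  split_ifs <;> ring

lemma fourier_flipStep {n k : ℕ} (hk : k ≤ n) (y : Cube n) :
    fourier (flipStep n k) (walsh y)
      = krawtchouk n (hammingNorm y) k / n.choose (hammingNorm y) := by
  have hy : hammingNorm y ≤ n := hammingNorm_le_card_fintype.trans_eq (Fintype.card_fin n)
  have hy' : (n.choose (hammingNorm y) : ℝ) ≠ 0 := by exact_mod_cast Nat.choose_ne_zero hy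
  have hk' : (n.choose k : ℝ) ≠ 0 := by exact_mod_cast Nat.choose_ne_zero hk
  have h : fourier (flipStep n k) (walsh y) = krawtchouk n k (hammingNorm y) / n.choose k := by
    have hsum := sum_walsh_filter_hammingNorm y k
    rw [Fintype.card_fin] at hsum
    simp only [fourier, flipStep, ite_mul, zero_mul, ← sum_filter, ← mul_sum, hsum]
    ring
  rw [h, div_eq_div_iff hk' hy', mul_comm, choose_mul_krawtchouk, mul_comm]

variable {k : ℕ}

lemma fourier_flipStep_sub_parityUniform (hodd : Odd k) (m : ℕ) (y : Cube (2 * k)) :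
    fourier (convPow (flipStep (2 * k) k) m - parityUniform m) (walsh y)
      = if hammingNorm y = 0 ∨ hammingNorm y = 2 * k then 0
        else (krawtchouk (2 * k) (hammingNorm y) k / (2 * k).choose (hammingNorm y)) ^ m := by
  have hk : 0 < k := hodd.pos
  have h_one : y = 1 ↔ hammingNorm y = 2 * k := by
    rw [← hammingNorm_eq_card_iff, Fintype.card_fin]
  rw [fourier_sub, fourier_convPow, fourier_flipStep (by omega), fourier_parityUniform]
  simp only [← hammingNorm_eq_zero (x := y), h_one]
  rcases eq_or_ne (hammingNorm y) 0 with h0 | h0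
  · simp [h0, krawtchouk_two_mul, hk.ne']
  rcases eq_or_ne (hammingNorm y) (2 * k) with h1 | h1
  · simp [h1, krawtchouk_two_mul, hk.ne', hodd.neg_one_pow]
  · simp [h0, h1]

lemma sum_sq_fourier_flipStep_sub_parityUniform_le (hodd : Odd k) (m : ℕ) :
    ∑ y, fourier (convPow (flipStep (2 * k) k) (m + 1) - parityUniform (m + 1)) (walsh y) ^ 2
      ≤ (2 * k + 1) * ((1 / k : ℝ) ^ m) ^ 2 := by
  let coeff (j : ℕ) : ℝ := if j = 0 ∨ j = 2 * k then 0
    else (krawtchouk (2 * k) j k / (2 * k).choose j) ^ (m + 1)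
  have h : ∀ j ∈ range (2 * k + 1), (2 * k).choose j * coeff j ^ 2 ≤ ((1 / k : ℝ) ^ m) ^ 2 := by
    intro j hj
    rw [mem_range] at hj
    by_cases hj' : j = 0 ∨ j = 2 * k
    · simp only [coeff, if_pos hj', zero_pow two_ne_zero, mul_zero]
      positivity
    · simp only [coeff, if_neg hj']
      exact choose_mul_krawtchouk_div_choose_pow_le (by omega) (by omega) m
  calc ∑ y, fourier (convPow (flipStep (2 * k) k) (m + 1) - parityUniform (m + 1)) (walsh y) ^ 2
      = ∑ y : Cube (2 * k), coeff (hammingNorm y) ^ 2 := by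
        simp_rw [fourier_flipStep_sub_parityUniform hodd, coeff]
    _ = ∑ j ∈ range (2 * k + 1), (2 * k).choose j * coeff j ^ 2 := by
        rw [sum_comp_hammingNorm fun j => coeff j ^ 2, Fintype.card_fin]
    _ ≤ ∑ _j ∈ range (2 * k + 1), ((1 / k : ℝ) ^ m) ^ 2 := sum_le_sum h
    _ = (2 * k + 1) * ((1 / k : ℝ) ^ m) ^ 2 := by simp

lemma tvDist_flipStep_parityUniform_le (hodd : Odd k) (hk : 3 ≤ k) (m : ℕ) :
    tvDist (convPow (flipStep (2 * k) k) m) (parityUniform m) ≤ (k : ℝ) ^ 2 / 2 * (1 / k) ^ m := by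
  have hk' : (3 : ℝ) ≤ k := by exact_mod_cast hk
  cases m with
  | zero =>
    have : Nonempty (Fin (2 * k)) := ⟨⟨0, by omega⟩⟩
    have h_nonneg : 0 ≤ (Pi.single 0 1 : Cube (2 * k) → ℝ) := Pi.single_nonneg.mpr zero_le_one
    have h := tvDist_le_one h_nonneg (parityUniform_nonneg 0) (by simp) (sum_parityUniform 0)
    rw [convPow]
    nlinarith
  | succ m =>
    have h : (2 * tvDist (convPow (flipStep (2 * k) k) (m + 1)) (parityUniform (m + 1))) ^ 2
        ≤ (k * (1 / k : ℝ) ^ m) ^ 2 := by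
      refine (sq_two_mul_tvDist_le _ _).trans
        ((sum_sq_fourier_flipStep_sub_parityUniform_le hodd m).trans ?_)
      rw [mul_pow]
      gcongr
      nlinarith
    have h' := abs_le_of_sq_le_sq h (by positivity)
    calc tvDist (convPow (flipStep (2 * k) k) (m + 1)) (parityUniform (m + 1))
        ≤ k * (1 / k : ℝ) ^ m / 2 := by linarith [le_abs_self (2 * tvDist
            (convPow (flipStep (2 * k) k) (m + 1)) (parityUniform (m + 1)))]
      _ = (k : ℝ) ^ 2 / 2 * (1 / k) ^ (m + 1) := by
        rw [pow_succ _ m]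
        field_simp

lemma tvDist_lazyFlip_uniform_le (hodd : Odd k) (hk : 3 ≤ k) {l : ℕ} (hl : l ≠ 0) :
    tvDist (convPow (lazyFlip (2 * k) k) l) (uniform (Cube (2 * k)))
      ≤ (k : ℝ) ^ 2 / 2 * ((1 / k + 1) / 2) ^ l := by
  rw [lazyFlip_eq_smul_flipStep_add_single, convPow_lazy, uniform_eq_sum_parityUniform hl]
  calc _ ≤ ∑ m ∈ range (l + 1), binomWeight l m *
        tvDist (convPow (flipStep (2 * k) k) m) (parityUniform m) :=
        tvDist_sum_smul_le (fun m _ => binomWeight_nonneg l m) _ _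
    _ ≤ ∑ m ∈ range (l + 1), binomWeight l m * ((k : ℝ) ^ 2 / 2 * (1 / k) ^ m) := by
        gcongr with m
        · exact binomWeight_nonneg l m
        · exact tvDist_flipStep_parityUniform_le hodd hk m
    _ = (k : ℝ) ^ 2 / 2 * ((1 / k + 1) / 2) ^ l := by
        simp only [← sum_binomWeight_mul_pow, mul_sum, mul_left_comm]

end FlipWalk

section Estimates

lemma two_thirds_le_exp : (2 / 3 : ℝ) ≤ Real.exp (-(3 / 8)) :=
  calc (2 / 3 : ℝ) ≤ (1 - 3 / 8 / (3 : ℕ)) ^ 3 := by norm_num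
    _ ≤ Real.exp (-(3 / 8)) := Real.one_sub_div_pow_le_exp_neg (by norm_num)

lemma sq_le_six_mul_exp {c : ℝ} (hc : 0 ≤ c) : c ^ 2 ≤ 6 * Real.exp (3 / 8 * c) := by
  have h : c ≤ 12 / 5 * Real.exp (3 / 16 * c) := by
    nlinarith [Real.quadratic_le_exp_of_nonneg (by positivity : 0 ≤ 3 / 16 * c),
      sq_nonneg (c - 13 / 2)]
  calc c ^ 2 ≤ (12 / 5 * Real.exp (3 / 16 * c)) ^ 2 := by gcongr
    _ = (12 / 5) ^ 2 * Real.exp (3 / 8 * c) := by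
        rw [mul_pow, ← Real.exp_nat_mul]
        ring_nf
    _ ≤ 6 * Real.exp (3 / 8 * c) := by
        gcongr
        norm_num

lemma half_sq_mul_pow_le {k l : ℕ} {c : ℝ} (hk : 3 ≤ k) (hc : 0 < c)
    (hl : 8 * Real.log k + c * √(Real.log k) ≤ l) :
    (k : ℝ) ^ 2 / 2 * ((1 / k + 1) / 2) ^ l ≤ 1 / c ^ 2 := by
  have hk3 : (3 : ℝ) ≤ k := by exact_mod_cast hk
  have hk0 : (0 : ℝ) < k := by linarith
  have hlog : 1 ≤ Real.log k := by
    rw [Real.le_log_iff_exp_le hk0]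
    exact Real.exp_one_lt_three.le.trans hk3
  have hl' : 8 * Real.log k + c ≤ l := by
    linarith [le_mul_of_one_le_right hc.le (Real.one_le_sqrt.mpr hlog)]
  have h_base : (1 / k + 1 : ℝ) / 2 ≤ Real.exp (-(3 / 8)) := by
    have : (1 / k : ℝ) ≤ 1 / 3 := by gcongr
    linarith [two_thirds_le_exp]
  have h_pow : ((1 / k + 1 : ℝ) / 2) ^ l ≤ Real.exp (-(3 / 8 * c)) / k ^ 3 :=
    calc ((1 / k + 1 : ℝ) / 2) ^ l ≤ Real.exp (-(3 / 8)) ^ l := by gcongr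
      _ = Real.exp (l * -(3 / 8)) := (Real.exp_nat_mul _ _).symm
      _ ≤ Real.exp (-(3 / 8 * c) - (3 : ℕ) * Real.log k) := by
          gcongr
          push_cast
          linarith
      _ = Real.exp (-(3 / 8 * c)) / k ^ 3 := by
          rw [Real.exp_sub, Real.exp_nat_mul, Real.exp_log hk0]
  calc (k : ℝ) ^ 2 / 2 * ((1 / k + 1) / 2) ^ l
      ≤ (k : ℝ) ^ 2 / 2 * (Real.exp (-(3 / 8 * c)) / k ^ 3) := by gcongr
    _ = 1 / (2 * k * Real.exp (3 / 8 * c)) := by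
        rw [Real.exp_neg]
        field_simp
    _ ≤ 1 / c ^ 2 := by
        gcongr
        refine (sq_le_six_mul_exp hc.le).trans ?_
        gcongr
        linarith

end Estimates

end KFlip

theorem theorem3 (n k : ℕ) (hn : n = 2 * k) (hodd : Odd k) (hk : 1 < k)
    (c : ℝ) (hc : 0 < c) (l : ℕ)
    (hl : 8 * Real.log ((n : ℝ) / 2) + c * √(Real.log ((n : ℝ) / 2)) ≤ (l : ℝ)) :
    KFlip.tvDist (KFlip.convPow (KFlip.lazyFlip n k) l) (KFlip.uniform (KFlip.Cube n))
      ≤ 1 / c ^ 2 := by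
  subst hn
  have hk3 : 3 ≤ k := by
    obtain ⟨t, rfl⟩ := hodd
    omega
  rw [Nat.cast_mul, Nat.cast_two, mul_div_cancel_left₀ _ two_ne_zero] at hl
  have hl0 : l ≠ 0 := by
    have hlog : 0 < Real.log k := Real.log_pos (by exact_mod_cast hk)
    have hl_pos : (0 : ℝ) < l := lt_of_lt_of_le (by positivity) hl
    exact_mod_cast hl_pos.ne'
  exact (KFlip.tvDist_lazyFlip_uniform_le hodd hk3 hl0).trans (KFlip.half_sq_mul_pow_le hk3 hc hl)
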